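/- A Perron number of degree $n\ge 2$ is a real algebraic integer $\alpha$ of degree $n$ with conjugates $\alpha_1=\alpha,\alpha_2,\dots,\alpha_n$ such that $\alpha>|\alpha_i|$ for $i=2,\dots,n$. For every $n>2$ there is a smallest Perron number of degree $n$. Assume the Lind–Boyd conjecture: for every $n>2$, the smallest Perron number of degree $n$ has minimal polynomial \[ \begin{cases} x^n-x-1 & \text{if } n\not\equiv 3,5 \pmod 6,\\ (x^{n+2}-x^4-1)/(x^2-x+1) & \text{if } n\equiv 3 \pmod 6,\\ (x^{n+2}-x^2-1)/(x^2-x+1) & \text{if } n\equiv 5 \pmod 6. \end{cases} \] For $n>2$ let $\nu_n$ be the number of conjugates $\alpha_i$ of the smallest Perron number of degree $n$ with $|\alpha_i|>1$. Then $\nu_n\sim\frac23 n$ as $n\to\infty$. -/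

import Mathlib

open Polynomial Filter Asymptotics

/-- The complex conjugates of a real number `α`: the complex roots of its minimal polynomial
over `ℚ` (for `α` algebraic of degree `n` there are exactly `n` of them, as the minimal
polynomial is separable). -/
noncomputable def conjugates (α : ℝ) : Set ℂ :=
  (minpoly ℚ α).rootSet ℂ

/-- A Perron number of degree `n`: a real algebraic integer of degree `n ≥ 2` which is strictly
larger than the modulus of each of its other conjugates. -/
structure IsPerron (n : ℕ) (α : ℝ) : Prop where
  isIntegral : IsIntegral ℤ α
  degree_eq : (minpoly ℚ α).natDegree = n
  two_le : 2 ≤ n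
  dominant : ∀ z ∈ conjugates α, z ≠ (α : ℂ) → ‖z‖ < α

/-- `α` is the smallest Perron number of degree `n`. -/
def IsSmallestPerron (n : ℕ) (α : ℝ) : Prop :=
  IsLeast {β : ℝ | IsPerron n β} α

/-- The number of conjugates of `α` of modulus greater than `1`. -/
noncomputable def nu (α : ℝ) : ℕ :=
  {z ∈ conjugates α | 1 < ‖z‖}.ncard

/-- The Lind–Boyd conjecture on the minimal polynomials of the smallest Perron numbers. The
quotients by `X ^ 2 - X + 1` are written as products. -/
def LindBoydConjecture : Prop :=
  ∀ (n : ℕ) (α : ℝ), 2 < n → IsSmallestPerron n α →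
    (n % 6 ≠ 3 → n % 6 ≠ 5 → minpoly ℚ α = X ^ n - X - 1) ∧
    (n % 6 = 3 → minpoly ℚ α * (X ^ 2 - X + 1) = X ^ (n + 2) - X ^ 4 - 1) ∧
    (n % 6 = 5 → minpoly ℚ α * (X ^ 2 - X + 1) = X ^ (n + 2) - X ^ 2 - 1)

/-!
A root `z` of `X ^ N - X ^ k - 1` satisfies `‖z‖ ^ N = ‖1 + z ^ k‖`, so it lies outside the unit
circle exactly when `1 < ‖1 + z ^ k‖`. For fixed `k` and `N → ∞` all roots approach the unit circle,
and by Newton's identities their power sums of exponent `0 < m < N - k` vanish; hence, by Weyl's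
criterion, the points `z ^ k` become equidistributed on the circle. Since `1 < ‖1 + exp (t * I)‖`
means `|t| < 2 * π / 3`, a proportion `2 / 3` of the roots lies outside the unit circle. The factor
`X ^ 2 - X + 1` contributes only sixth roots of unity.

By the strict triangle inequality, the positive root of `x ^ n = x + 1` is a Perron number of degree
`n`. There is a smallest one because only finitely many algebraic integers of given degree have all
their conjugates in a given disc.
-/

section Convergence

open Topology MeasureTheory

variable {ι Ω E : Type*} {l : Filter ι} [MeasurableSpace Ω]

theorem tendsto_integral_zero_of_tendsto_bind_ae [NormedAddCommGroup E] [NormedSpace ℝ E]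
    {μ : ι → ProbabilityMeasure Ω} {f : Ω → E}
    (hf : Tendsto f (l.bind fun i ↦ ae (μ i : Measure Ω)) (𝓝 0)) :
    Tendsto (fun i ↦ ∫ ω, f ω ∂(μ i : Measure Ω)) l (𝓝 0) := by
  refine (Metric.nhds_basis_closedBall.tendsto_right_iff).2 fun ε hε ↦ ?_
  have hclose := hf.eventually (Metric.closedBall_mem_nhds 0 hε)
  filter_upwards [eventually_bind.1 hclose] with i hi
  simpa using norm_integral_le_of_norm_le_const (hi.mono fun ω hω ↦ mem_closedBall_zero_iff.1 hω)

theorem tendsto_map_of_tendsto_dist_zero [l.IsCountablyGenerated] [PseudoMetricSpace E]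
    [MeasurableSpace E] [OpensMeasurableSpace E] {μ : ι → ProbabilityMeasure Ω}
    {ν : ProbabilityMeasure E} {X Y : Ω → E} (hX : Measurable X) (hY : Measurable Y)
    (hdist : Tendsto (fun ω ↦ dist (X ω) (Y ω)) (l.bind fun i ↦ ae (μ i : Measure Ω)) (𝓝 0))
    (hlim : Tendsto (fun i ↦ (μ i).map hX.aemeasurable) l (𝓝 ν)) :
    Tendsto (fun i ↦ (μ i).map hY.aemeasurable) l (𝓝 ν) := by
  rw [tendsto_iff_forall_lipschitz_integral_tendsto] at hlim ⊢
  rintro f hf_bdd ⟨K, hf_lip⟩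
  have integrable_comp {Z : Ω → E} (hZ : Measurable Z) (i : ι) :
      Integrable (fun ω ↦ f (Z ω)) (μ i : Measure Ω) := by
    have := Measure.isProbabilityMeasure_map (μ := (μ i : Measure Ω)) hZ.aemeasurable
    obtain ⟨C, hC⟩ := hf_bdd
    exact ((BoundedContinuousFunction.mkOfBound ⟨f, hf_lip.continuous⟩ C hC).integrable
      ((μ i : Measure Ω).map Z)).comp_measurable hZ
  have hdiff : Tendsto (fun ω ↦ f (Y ω) - f (X ω)) (l.bind fun i ↦ ae (μ i : Measure Ω)) (𝓝 0) := by
    refine squeeze_zero_norm (fun ω ↦ ?_) (by simpa using hdist.const_mul (K : ℝ))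
    rw [← dist_eq_norm, dist_comm]
    exact hf_lip.dist_le_mul _ _
  have hsum := (hlim f hf_bdd ⟨K, hf_lip⟩).add (tendsto_integral_zero_of_tendsto_bind_ae hdiff)
  rw [add_zero] at hsum
  refine hsum.congr fun i ↦ ?_
  have hmeas : StronglyMeasurable f := hf_lip.continuous.measurable.stronglyMeasurable
  rw [ProbabilityMeasure.toMeasure_map, ProbabilityMeasure.toMeasure_map,
    integral_map hX.aemeasurable hmeas.aestronglyMeasurable,
    integral_map hY.aemeasurable hmeas.aestronglyMeasurable,
    integral_sub (integrable_comp hY i) (integrable_comp hX i), add_sub_cancel]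

end Convergence

section Weyl

open Topology MeasureTheory AddCircle Real

variable {ι : Type*} {l : Filter ι}

theorem tendsto_integral_of_mem_span {K : Type*} [TopologicalSpace K] [CompactSpace K]
    [MeasurableSpace K] [BorelSpace K] {μ : ι → ProbabilityMeasure K} {ν : ProbabilityMeasure K}
    {S : Set C(K, ℂ)}
    (h : ∀ f ∈ S, Tendsto (fun i ↦ ∫ x, f x ∂(μ i : Measure K)) l (𝓝 (∫ x, f x ∂(ν : Measure K))))
    {f : C(K, ℂ)} (hf : f ∈ Submodule.span ℂ S) :
    Tendsto (fun i ↦ ∫ x, f x ∂(μ i : Measure K)) l (𝓝 (∫ x, f x ∂(ν : Measure K))) := by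
  induction hf using Submodule.span_induction with
  | mem f hf => exact h f hf
  | zero => simpa using tendsto_const_nhds
  | add f g _ _ hf hg =>
    have integrable (ρ : ProbabilityMeasure K) (f : C(K, ℂ)) : Integrable f (ρ : Measure K) :=
      (BoundedContinuousFunction.mkOfCompact f).integrable _
    simp only [ContinuousMap.add_apply, integral_add (integrable _ f) (integrable _ g)]
    exact hf.add hg
  | smul c f _ hf =>
    simp only [ContinuousMap.smul_apply, integral_smul]
    exact hf.const_smul c

variable {T : ℝ} [Fact (0 < T)]

theorem integral_fourier_haarAddCircle (n : ℤ) :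
    ∫ t : AddCircle T, fourier n t ∂haarAddCircle = if n = 0 then 1 else 0 := by
  have h := congrFun (fourierCoeff_fourier (T := T) n) 0
  simpa [fourierCoeff, Pi.single_apply, eq_comm] using h

theorem tendsto_integral_fourier_of_natCast {μ : ι → ProbabilityMeasure (AddCircle T)}
    (h : ∀ m : ℕ, m ≠ 0 →
      Tendsto (fun i ↦ ∫ t, fourier (T := T) m t ∂(μ i : Measure (AddCircle T))) l (𝓝 0)) (n : ℤ) :
    Tendsto (fun i ↦ ∫ t, fourier n t ∂(μ i : Measure (AddCircle T))) l
      (𝓝 (∫ t : AddCircle T, fourier n t ∂haarAddCircle)) := by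
  rcases eq_or_ne n 0 with rfl | hn
  · simpa using tendsto_const_nhds
  rw [integral_fourier_haarAddCircle, if_neg hn]
  obtain ⟨m, rfl | rfl⟩ := n.eq_nat_or_neg
  · exact h m (by simpa using hn)
  · simpa only [fourier_neg, integral_conj, map_zero, Function.comp_def] using
      (Complex.continuous_conj.tendsto 0).comp (h m (by simpa using hn))

theorem tendsto_haarAddCircle_of_tendsto_integral_fourier {μ : ι → ProbabilityMeasure (AddCircle T)}
    (h : ∀ m : ℕ, m ≠ 0 →
      Tendsto (fun i ↦ ∫ t, fourier (T := T) m t ∂(μ i : Measure (AddCircle T))) l (𝓝 0)) :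
    Tendsto μ l (𝓝 ⟨haarAddCircle, inferInstance⟩) := by
  let toC := BoundedContinuousFunction.toContinuousMapStarₐ (α := AddCircle T) (β := ℂ) ℂ
  refine ProbabilityMeasure.tendsto_of_tight_of_separatesPoints (𝕜 := ℂ)
    IsTightMeasureSet.of_compactSpace (A := fourierSubalgebra.comap toC) ?_ fun g hg ↦ ?_
  · intro s t hst
    obtain ⟨_, ⟨f, hf, rfl⟩, hne⟩ := fourierSubalgebra_separatesPoints hst
    exact ⟨f, ⟨f, ⟨.mkOfCompact f, hf, rfl⟩, rfl⟩, hne⟩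
  · have hspan : toC g ∈ Submodule.span ℂ (Set.range (fourier (T := T))) := by
      rwa [← fourierSubalgebra_coe]
    exact tendsto_integral_of_mem_span (ν := ⟨haarAddCircle, inferInstance⟩)
      (Set.forall_mem_range.2 (tendsto_integral_fourier_of_natCast h)) hspan

local instance : Fact (0 < 2 * π) := ⟨two_pi_pos⟩

/-- The uniform probability measure on the unit circle, as a measure on the complex plane: the
image of the Haar measure of `AddCircle (2 * π)`. -/
noncomputable def circleMeasure : ProbabilityMeasure ℂ :=
  ⟨haarAddCircle.map (fourier (T := 2 * π) 1), Measure.isProbabilityMeasure_map (by fun_prop)⟩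

theorem pow_eq_norm_pow_mul_fourier_arg (z : ℂ) (m : ℕ) :
    z ^ m = (‖z‖ ^ m : ℝ) * fourier (T := 2 * π) m (z.arg : AddCircle (2 * π)) := by
  conv_lhs => rw [← Complex.norm_mul_exp_arg_mul_I z, mul_pow, ← Complex.exp_nat_mul]
  rw [fourier_coe_apply, Complex.ofReal_pow]
  congr 2
  push_cast
  field_simp

theorem tendsto_pow_sub_fourier_arg {F : Filter ℂ} (hF : Tendsto (‖·‖) F (𝓝 1)) (m : ℕ) :
    Tendsto (fun z ↦ z ^ m - fourier (T := 2 * π) m (z.arg : AddCircle (2 * π))) F (𝓝 0) := by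
  rw [tendsto_zero_iff_norm_tendsto_zero]
  have hpow : Tendsto (fun z : ℂ ↦ |‖z‖ ^ m - 1|) F (𝓝 0) := by
    simpa using ((hF.pow m).sub_const 1).abs
  refine hpow.congr fun z ↦ ?_
  rw [pow_eq_norm_pow_mul_fourier_arg, ← sub_one_mul, norm_mul, fourier_apply, Circle.norm_coe,
    mul_one, ← Complex.ofReal_one, ← Complex.ofReal_sub, Complex.norm_real, norm_eq_abs]

theorem eventually_integrable_pow {μ : ι → ProbabilityMeasure ℂ}
    (hnorm : Tendsto (‖·‖) (l.bind fun i ↦ ae (μ i : Measure ℂ)) (𝓝 1)) (m : ℕ) :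
    ∀ᶠ i in l, Integrable (· ^ m) (μ i : Measure ℂ) := by
  filter_upwards [eventually_bind.1 (hnorm.eventually_le_const one_lt_two)] with i hi
  refine .of_bound (by fun_prop) (2 ^ m) (hi.mono fun z hz ↦ ?_)
  rw [norm_pow]
  gcongr

theorem tendsto_circleMeasure_of_tendsto_integral_pow [l.IsCountablyGenerated]
    {μ : ι → ProbabilityMeasure ℂ}
    (hnorm : Tendsto (‖·‖) (l.bind fun i ↦ ae (μ i : Measure ℂ)) (𝓝 1))
    (hmoment : ∀ m : ℕ, m ≠ 0 → Tendsto (fun i ↦ ∫ z, z ^ m ∂(μ i : Measure ℂ)) l (𝓝 0)) :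
    Tendsto μ l (𝓝 circleMeasure) := by
  let angle (z : ℂ) : AddCircle (2 * π) := (z.arg : AddCircle (2 * π))
  have measurable_angle : Measurable angle := AddCircle.measurable_mk'.comp Complex.measurable_arg
  have hangle : Tendsto (fun i ↦ (μ i).map measurable_angle.aemeasurable) l
      (𝓝 ⟨haarAddCircle, inferInstance⟩) := by
    refine tendsto_haarAddCircle_of_tendsto_integral_fourier fun m hm ↦ ?_
    have hdiff := (hmoment m hm).sub
      (tendsto_integral_zero_of_tendsto_bind_ae (tendsto_pow_sub_fourier_arg hnorm m))
    rw [sub_zero] at hdiff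
    refine hdiff.congr' ?_
    filter_upwards [eventually_integrable_pow hnorm m] with i hpow
    have hfourier : Integrable (fun z ↦ fourier (T := 2 * π) m (angle z)) (μ i : Measure ℂ) :=
      .of_bound (by fun_prop) 1 (ae_of_all _ fun z ↦ by rw [fourier_apply, Circle.norm_coe])
    rw [integral_sub hpow hfourier, sub_sub_cancel, ProbabilityMeasure.toMeasure_map,
      integral_map measurable_angle.aemeasurable (by fun_prop)]
  have hcircle := ProbabilityMeasure.tendsto_map_of_tendsto_of_continuous _ _ hangle
    (fourier (T := 2 * π) 1).continuous
  have hdist : Tendsto (fun z ↦ dist (fourier 1 (angle z)) z) (l.bind fun i ↦ ae (μ i : Measure ℂ))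
      (𝓝 0) := by
    simpa [dist_eq_norm, norm_sub_rev, angle] using (tendsto_pow_sub_fourier_arg hnorm 1).norm
  have hmap := tendsto_map_of_tendsto_dist_zero
    ((fourier (T := 2 * π) 1).continuous.measurable.comp measurable_angle) measurable_id hdist
    (hcircle.congr fun i ↦ Subtype.ext (Measure.map_map (by fun_prop) measurable_angle))
  exact hmap.congr fun i ↦ Subtype.ext Measure.map_id

theorem circleMeasure_apply {A : Set ℂ} (hA : MeasurableSet A) :
    (circleMeasure : Measure ℂ) A =
      volume {t ∈ Set.Ioc (-π) π | Complex.exp (t * Complex.I) ∈ A} / ENNReal.ofReal (2 * π) := by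
  have hA' : MeasurableSet (fourier (T := 2 * π) 1 ⁻¹' A) := hA.preimage (by fun_prop)
  have hvol := (AddCircle.measurePreserving_mk (2 * π) (-π)).measure_preimage hA'.nullMeasurableSet
  have hpos : ENNReal.ofReal (2 * π) ≠ 0 := by simp [pi_pos]
  rw [Measure.restrict_apply (hA'.preimage AddCircle.measurable_mk'), volume_eq_smul_haarAddCircle,
    Measure.smul_apply, smul_eq_mul] at hvol
  have hmap : (circleMeasure : Measure ℂ) A = haarAddCircle (fourier (T := 2 * π) 1 ⁻¹' A) :=
    Measure.map_apply (by fun_prop) hA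
  rw [hmap, ENNReal.eq_div_iff hpos ENNReal.ofReal_ne_top]
  refine hvol.symm.trans (congrArg volume (Set.ext fun t ↦ ?_))
  have hfourier : fourier (T := 2 * π) 1 t = Complex.exp (t * Complex.I) := by
    rw [fourier_coe_apply]
    congr 1
    push_cast
    field_simp
  simp [hfourier, two_mul, and_comm]

theorem norm_one_add_exp_mul_I_sq (t : ℝ) :
    ‖1 + Complex.exp (t * Complex.I)‖ ^ 2 = 2 + 2 * cos t := by
  rw [Complex.sq_norm, Complex.normSq_add, Complex.normSq_one, ← Complex.sq_norm,
    Complex.norm_exp_ofReal_mul_I, one_mul, Complex.conj_re, Complex.exp_ofReal_mul_I_re]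
  ring

theorem cos_two_pi_div_three : cos (2 * π / 3) = -1 / 2 := by
  rw [show 2 * π / 3 = π - π / 3 by ring, cos_pi_sub, cos_pi_div_three, neg_div]

theorem one_lt_norm_one_add_exp_mul_I_iff {t : ℝ} (ht : |t| ≤ π) :
    1 < ‖1 + Complex.exp (t * Complex.I)‖ ↔ |t| < 2 * π / 3 := by
  rw [← strictAntiOn_cos.lt_iff_gt ⟨by positivity, by linarith [pi_pos]⟩ ⟨abs_nonneg t, ht⟩,
    cos_abs, cos_two_pi_div_three, ← one_lt_sq_iff₀ (norm_nonneg _), norm_one_add_exp_mul_I_sq]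
  constructor <;> intro h <;> linarith

theorem norm_one_add_exp_mul_I_eq_one_iff {t : ℝ} (ht : |t| ≤ π) :
    ‖1 + Complex.exp (t * Complex.I)‖ = 1 ↔ |t| = 2 * π / 3 := by
  rw [← strictAntiOn_cos.injOn.eq_iff ⟨abs_nonneg t, ht⟩ ⟨by positivity, by linarith [pi_pos]⟩,
    cos_abs, cos_two_pi_div_three, ← pow_eq_one_iff_of_nonneg (norm_nonneg _) two_ne_zero,
    norm_one_add_exp_mul_I_sq]
  constructor <;> intro h <;> linarith

theorem measurableSet_one_lt_norm_one_add : MeasurableSet {w : ℂ | 1 < ‖1 + w‖} :=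
  measurableSet_lt measurable_const (by fun_prop)

theorem circleMeasure_one_lt_norm_one_add :
    (circleMeasure : Measure ℂ) {w | 1 < ‖1 + w‖} = 2 / 3 := by
  have harc : {t ∈ Set.Ioc (-π) π | Complex.exp (t * Complex.I) ∈ {w | 1 < ‖1 + w‖}} =
      Set.Ioo (-(2 * π / 3)) (2 * π / 3) := by
    ext t
    simp only [Set.mem_ofPred_eq, Set.mem_Ioc, Set.mem_Ioo, ← abs_lt]
    constructor
    · rintro ⟨⟨hl, hu⟩, h⟩
      exact (one_lt_norm_one_add_exp_mul_I_iff (abs_le.2 ⟨hl.le, hu⟩)).1 h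
    · intro h
      have hπ : |t| < π := h.trans (by linarith [pi_pos])
      exact ⟨⟨(abs_lt.1 hπ).1, (abs_lt.1 hπ).2.le⟩, (one_lt_norm_one_add_exp_mul_I_iff hπ.le).2 h⟩
  rw [circleMeasure_apply measurableSet_one_lt_norm_one_add, harc, Real.volume_Ioo,
    ← ENNReal.ofReal_div_of_pos two_pi_pos]
  rw [show (2 * π / 3 - -(2 * π / 3)) / (2 * π) = 2 / 3 by field_simp; ring,
    ENNReal.ofReal_div_of_pos three_pos]
  simp

theorem circleMeasure_frontier_one_lt_norm_one_add :
    (circleMeasure : Measure ℂ) (frontier {w | 1 < ‖1 + w‖}) = 0 := by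
  have hsub : frontier {w : ℂ | 1 < ‖1 + w‖} ⊆ {w | ‖1 + w‖ = 1} :=
    (frontier_lt_subset_eq continuous_const (by fun_prop)).trans fun w hw ↦ Eq.symm hw
  refine measure_mono_null hsub ?_
  rw [circleMeasure_apply (measurableSet_eq_fun (by fun_prop) measurable_const),
    ENNReal.div_eq_zero_iff]
  have hfin : ({2 * π / 3, -(2 * π / 3)} : Set ℝ).Finite := Set.toFinite _
  refine .inl (measure_mono_null ?_ (hfin.measure_zero volume))
  rintro t ⟨⟨hl, hu⟩, h⟩
  exact eq_or_eq_neg_of_abs_eq ((norm_one_add_exp_mul_I_eq_one_iff (abs_le.2 ⟨hl.le, hu⟩)).1 h)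

end Weyl

section Empirical

open MeasureTheory
open scoped ENNReal

variable {Ω : Type*} [MeasurableSpace Ω]

/-- The empirical measure of a nonempty multiset: each element carries mass `s.card⁻¹`, counted
with multiplicity. For the empty multiset it is the zero measure. -/
noncomputable def empiricalMeasure (s : Multiset Ω) : Measure Ω :=
  (s.card : ℝ≥0∞)⁻¹ • (s.map Measure.dirac).sum

theorem sum_map_dirac_apply (s : Multiset Ω) {A : Set Ω} [DecidablePred (· ∈ A)]
    (hA : MeasurableSet A) : (s.map Measure.dirac).sum A = s.countP (· ∈ A) := by
  induction s using Multiset.induction_on with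
  | empty => simp
  | cons a s ih =>
    by_cases ha : a ∈ A <;> simp [ih, hA, ha, add_comm]

theorem empiricalMeasure_apply (s : Multiset Ω) {A : Set Ω} [DecidablePred (· ∈ A)]
    (hA : MeasurableSet A) : empiricalMeasure s A = s.countP (· ∈ A) / s.card := by
  rw [empiricalMeasure, Measure.smul_apply, sum_map_dirac_apply s hA, smul_eq_mul, mul_comm,
    ENNReal.div_eq_inv_mul, mul_comm]

theorem isProbabilityMeasure_empiricalMeasure {s : Multiset Ω} (hs : s ≠ 0) :
    IsProbabilityMeasure (empiricalMeasure s) := by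
  classical
  refine ⟨?_⟩
  have hcard : (s.card : ℝ≥0∞) ≠ 0 := by simpa using hs
  simpa [empiricalMeasure_apply s MeasurableSet.univ] using
    ENNReal.div_self hcard (ENNReal.natCast_ne_top _)

theorem ae_empiricalMeasure [MeasurableSingletonClass Ω] {s : Multiset Ω} {p : Ω → Prop}
    (h : ∀ z ∈ s, p z) : ∀ᵐ z ∂empiricalMeasure s, p z := by
  refine Measure.ae_smul_measure ?_ _
  induction s using Multiset.induction_on with
  | empty => simp
  | cons a s ih =>
    rw [Multiset.map_cons, Multiset.sum_cons, ae_add_measure_iff, ae_dirac_eq]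
    exact ⟨h a (s.mem_cons_self a), ih fun z hz ↦ h z (Multiset.mem_cons_of_mem hz)⟩

theorem integral_empiricalMeasure {E : Type*} [NormedAddCommGroup E] [NormedSpace ℝ E]
    [CompleteSpace E] [MeasurableSingletonClass Ω] (s : Multiset Ω) (f : Ω → E) :
    ∫ z, f z ∂empiricalMeasure s = (s.card : ℝ)⁻¹ • (s.map f).sum := by
  have hsum : Integrable f (s.map Measure.dirac).sum ∧
      ∫ z, f z ∂(s.map Measure.dirac).sum = (s.map f).sum := by
    induction s using Multiset.induction_on with
    | empty => simp
    | cons a s ih =>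
      have ha : Integrable f (Measure.dirac a) := integrable_dirac (by simp)
      rw [Multiset.map_cons, Multiset.sum_cons, Multiset.map_cons, Multiset.sum_cons]
      exact ⟨ha.add_measure ih.1, by rw [integral_add_measure ha ih.1, integral_dirac, ih.2]⟩
  rw [empiricalMeasure, integral_smul_measure, hsum.2]
  simp

end Empirical

section Newton

theorem sum_map_pow_eq_zero_of_esymm_eq_zero {R : Type*} [CommRing R] (s : Multiset R) {m : ℕ}
    (hm : 0 < m) (h : ∀ j, 0 < j → j ≤ m → s.esymm j = 0) : (s.map (· ^ m)).sum = 0 := by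
  classical
  let x : s.ToType → R := Sigma.fst
  have hx : Finset.univ.val.map x = s := s.map_univ_coe
  have hnewton := congrArg (MvPolynomial.aeval x)
    (MvPolynomial.psum_eq_mul_esymm_sub_sum s.ToType R m hm)
  simp only [map_sub, map_mul, map_sum, MvPolynomial.aeval_esymm_eq_multiset_esymm, hx,
    h m hm le_rfl, mul_zero, zero_sub] at hnewton
  rw [Finset.sum_eq_zero fun a ha ↦ ?_, neg_zero] at hnewton
  · simpa [MvPolynomial.psum, ← hx] using hnewton
  · obtain ⟨_, hpos, hlt⟩ := Finset.mem_filter.1 ha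
    rw [h a.1 hpos hlt.le, mul_zero, zero_mul]

theorem sum_roots_pow_eq_zero {R : Type*} [CommRing R] [IsDomain R] {p : R[X]}
    (hp : p.roots.card = p.natDegree) {m : ℕ} (hm : 0 < m) (hdeg : m ≤ p.natDegree)
    (h : ∀ j < p.natDegree, p.natDegree ≤ j + m → p.coeff j = 0) :
    (p.roots.map (· ^ m)).sum = 0 := by
  refine sum_map_pow_eq_zero_of_esymm_eq_zero _ hm fun j hj hjm ↦ ?_
  have hcoeff := coeff_eq_esymm_roots_of_card hp (k := p.natDegree - j) (by omega)
  rw [h _ (by omega) (by omega), Nat.sub_sub_self (by omega)] at hcoeff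
  have hlead : p.leadingCoeff ≠ 0 := by
    rw [Ne, leadingCoeff_eq_zero]
    rintro rfl
    exact hm.not_ge (by simpa using hdeg)
  simpa [hlead] using hcoeff.symm

end Newton

section Trinomial

open Topology

variable {R : Type*} [CommRing R] {N k : ℕ}

/-- The trinomial `X ^ N - X ^ k - 1`: the polynomials of the Lind–Boyd conjecture are of this
form, up to the factor `X ^ 2 - X + 1`. -/
noncomputable def perronTrinomial (R : Type*) [CommRing R] (N k : ℕ) : R[X] := X ^ N - X ^ k - 1

theorem map_perronTrinomial {S : Type*} [CommRing S] (f : R →+* S) (N k : ℕ) :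
    (perronTrinomial R N k).map f = perronTrinomial S N k := by
  simp [perronTrinomial]

theorem isRoot_perronTrinomial {z : R} : (perronTrinomial R N k).IsRoot z ↔ z ^ N = 1 + z ^ k := by
  simp only [perronTrinomial, IsRoot.def, eval_sub, eval_pow, eval_X, eval_one]
  constructor <;> intro h <;> linear_combination h

theorem coeff_perronTrinomial_eq_zero {j : ℕ} (hk : k < j) (hN : j < N) :
    (perronTrinomial R N k).coeff j = 0 := by
  simp [perronTrinomial, coeff_X_pow, coeff_one, hk.ne', hN.ne, (Nat.zero_le k).trans_lt hk |>.ne']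

theorem natDegree_perronTrinomial [Nontrivial R] (h : k < N) :
    (perronTrinomial R N k).natDegree = N := by
  have hN : N ≠ 0 := (Nat.zero_le k).trans_lt h |>.ne'
  unfold perronTrinomial
  compute_degree
  · simp [h.ne', hN]
  all_goals omega

theorem monic_perronTrinomial (h : k < N) : (perronTrinomial R N k).Monic := by
  nontriviality R
  have hN : N ≠ 0 := (Nat.zero_le k).trans_lt h |>.ne'
  rw [Monic, leadingCoeff, natDegree_perronTrinomial h]
  simp [perronTrinomial, coeff_X_pow, coeff_one, h.ne', hN]

theorem card_roots_perronTrinomial {K : Type*} [Field K] [IsAlgClosed K] (h : k < N) :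
    (perronTrinomial K N k).roots.card = N := by
  rw [IsAlgClosed.card_roots_eq_natDegree, natDegree_perronTrinomial h]

theorem sum_roots_perronTrinomial_pow_eq_zero {K : Type*} [Field K] [IsAlgClosed K] {m : ℕ}
    (hm : 0 < m) (h : m + k < N) : ((perronTrinomial K N k).roots.map (· ^ m)).sum = 0 := by
  have hdeg : (perronTrinomial K N k).natDegree = N := natDegree_perronTrinomial (by omega)
  refine sum_roots_pow_eq_zero IsAlgClosed.card_roots_eq_natDegree hm (by omega) fun j hj hjm ↦ ?_
  exact coeff_perronTrinomial_eq_zero (by omega) (by omega)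

variable {D : Type*} [NormedDivisionRing D]

theorem eventually_lt_norm_of_pow_eq (hk : k ≠ 0) {a : ℝ} (ha : a < 1) :
    ∀ᶠ N : ℕ in atTop, ∀ z : D, z ^ N = 1 + z ^ k → a < ‖z‖ := by
  rcases lt_or_ge a 0 with ha0 | ha0
  · exact .of_forall fun N z _ ↦ ha0.trans_le (norm_nonneg z)
  have hlim : Tendsto (fun N ↦ a ^ N + a ^ k) atTop (𝓝 (0 + a ^ k)) :=
    (tendsto_pow_atTop_nhds_zero_of_lt_one ha0 ha).add_const _
  have hlt : 0 + a ^ k < 1 := by simpa using pow_lt_one₀ ha0 ha hk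
  filter_upwards [hlim.eventually_lt_const hlt] with N hN z hz
  by_contra! hle
  refine hN.not_ge ?_
  calc (1 : ℝ) = ‖(1 + z ^ k) - z ^ k‖ := by simp
    _ ≤ ‖z‖ ^ N + ‖z‖ ^ k := by
      rw [← hz, ← norm_pow, ← norm_pow]
      exact norm_sub_le _ _
    _ ≤ a ^ N + a ^ k := by gcongr

theorem eventually_norm_lt_of_pow_eq (k : ℕ) {b : ℝ} (hb : 1 < b) :
    ∀ᶠ N : ℕ in atTop, ∀ z : D, z ^ N = 1 + z ^ k → ‖z‖ < b := by
  have hlarge := (tendsto_pow_atTop_atTop_of_one_lt hb).eventually_gt_atTop 2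
  filter_upwards [(tendsto_sub_atTop_nat k).eventually hlarge, eventually_ge_atTop k]
    with N hN hkN z hz
  by_contra! hle
  refine hN.not_ge ?_
  have hz1 : 1 ≤ ‖z‖ := hb.le.trans hle
  have hpos : 0 < ‖z‖ ^ k := by positivity
  have hbound : ‖z‖ ^ (N - k) * ‖z‖ ^ k ≤ 2 * ‖z‖ ^ k :=
    calc ‖z‖ ^ (N - k) * ‖z‖ ^ k = ‖1 + z ^ k‖ := by
          rw [← pow_add, Nat.sub_add_cancel hkN, ← norm_pow, hz]
      _ ≤ 1 + ‖z‖ ^ k := by simpa using norm_add_le 1 (z ^ k)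
      _ ≤ 2 * ‖z‖ ^ k := by linarith [one_le_pow₀ (n := k) hz1]
  calc b ^ (N - k) ≤ ‖z‖ ^ (N - k) := by gcongr
    _ ≤ 2 := le_of_mul_le_mul_right hbound hpos

theorem tendsto_norm_of_pow_eq (hk : k ≠ 0) :
    Tendsto (‖·‖) (atTop.bind fun N ↦ 𝓟 {z : D | z ^ N = 1 + z ^ k}) (𝓝 1) := by
  refine tendsto_order.2 ⟨fun a ha ↦ ?_, fun b hb ↦ ?_⟩
  · exact eventually_bind.2 (by simpa using eventually_lt_norm_of_pow_eq hk ha)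
  · exact eventually_bind.2 (by simpa using eventually_norm_lt_of_pow_eq k hb)

theorem one_lt_norm_iff_of_pow_eq (hN : N ≠ 0) {z : D} (hz : z ^ N = 1 + z ^ k) :
    1 < ‖z‖ ↔ 1 < ‖1 + z ^ k‖ := by
  rw [← hz, norm_pow, one_lt_pow_iff_of_nonneg (norm_nonneg z) hN]

end Trinomial

section RootDensity

open Topology MeasureTheory

theorem tendsto_countP_div_card_of_tendsto_sum_pow {ι : Type*} {l : Filter ι}
    [l.IsCountablyGenerated] {s : ι → Multiset ℂ} (hs : ∀ i, s i ≠ 0)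
    (hnorm : Tendsto (‖·‖) (l.bind fun i ↦ 𝓟 {z | z ∈ s i}) (𝓝 1))
    (hmoment : ∀ m : ℕ, m ≠ 0 →
      Tendsto (fun i ↦ ((s i).card : ℝ)⁻¹ • ((s i).map (· ^ m)).sum) l (𝓝 0))
    {A : Set ℂ} [DecidablePred (· ∈ A)] (hA : MeasurableSet A)
    (hfrontier : (circleMeasure : Measure ℂ) (frontier A) = 0) :
    Tendsto (fun i ↦ ((s i).countP (· ∈ A) : ℝ) / (s i).card) l
      (𝓝 ((circleMeasure : Measure ℂ) A).toReal) := by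
  let μ (i : ι) : ProbabilityMeasure ℂ :=
    ⟨empiricalMeasure (s i), isProbabilityMeasure_empiricalMeasure (hs i)⟩
  have hnorm_ae : Tendsto (‖·‖) (l.bind fun i ↦ ae (μ i : Measure ℂ)) (𝓝 1) :=
    hnorm.mono_left (bind_mono le_rfl (.of_forall fun i ↦ le_principal_iff.2
      (ae_empiricalMeasure fun _ ↦ id)))
  have hμ : Tendsto μ l (𝓝 circleMeasure) :=
    tendsto_circleMeasure_of_tendsto_integral_pow hnorm_ae fun m hm ↦
      (hmoment m hm).congr fun i ↦ (integral_empiricalMeasure (s i) _).symm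
  have hA_lim := ProbabilityMeasure.tendsto_measure_of_null_frontier_of_tendsto' hμ hfrontier
  refine ((ENNReal.tendsto_toReal (measure_ne_top _ A)).comp hA_lim).congr fun i ↦ ?_
  simp [μ, empiricalMeasure_apply (s i) hA]

theorem pow_eq_of_mem_roots_perronTrinomial {R : Type*} [CommRing R] [IsDomain R] {N k : ℕ} {z : R}
    (hz : z ∈ (perronTrinomial R N k).roots) : z ^ N = 1 + z ^ k :=
  isRoot_perronTrinomial.1 (isRoot_of_mem_roots hz)

theorem countP_one_lt_norm_roots_perronTrinomial {N k : ℕ} (hN : N ≠ 0)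
    [DecidablePred (· ∈ {w : ℂ | 1 < ‖1 + w‖})] :
    (perronTrinomial ℂ N k).roots.countP (1 < ‖·‖) =
      ((perronTrinomial ℂ N k).roots.map (· ^ k)).countP (· ∈ {w : ℂ | 1 < ‖1 + w‖}) := by
  rw [Multiset.countP_map, ← Multiset.countP_eq_card_filter]
  exact Multiset.countP_congr rfl fun z hz ↦ propext <|
    one_lt_norm_iff_of_pow_eq hN (pow_eq_of_mem_roots_perronTrinomial hz)

theorem tendsto_norm_pow_roots_perronTrinomial {ι : Type*} {l : Filter ι} {N : ι → ℕ}
    (hN : Tendsto N l atTop) {k : ℕ} (hk : k ≠ 0) :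
    Tendsto (‖·‖)
      (l.bind fun i ↦ 𝓟 {w | w ∈ (perronTrinomial ℂ (N i) k).roots.map (· ^ k)}) (𝓝 1) := by
  intro U hU
  have hpow := (tendsto_norm_of_pow_eq (D := ℂ) hk).pow k
  rw [one_pow] at hpow
  refine eventually_bind.2 ((hN.eventually (eventually_bind.1 (hpow.eventually_mem hU))).mono ?_)
  intro i hi w hw
  obtain ⟨z, hz, rfl⟩ := Multiset.mem_map.1 hw
  simpa using hi (pow_eq_of_mem_roots_perronTrinomial hz)

theorem tendsto_countP_roots_perronTrinomial_div {k : ℕ} (hk : k ≠ 0) :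
    Tendsto (fun N : ℕ ↦ ((perronTrinomial ℂ N k).roots.countP (1 < ‖·‖) : ℝ) / N) atTop
      (𝓝 (2 / 3)) := by
  classical
  rw [← tendsto_add_atTop_iff_nat (k + 1)]
  have hk_lt (n : ℕ) : k < n + (k + 1) := by omega
  let s (n : ℕ) : Multiset ℂ := (perronTrinomial ℂ (n + (k + 1)) k).roots.map (· ^ k)
  have hcard (n : ℕ) : (s n).card = n + (k + 1) := by
    rw [Multiset.card_map, card_roots_perronTrinomial (hk_lt n)]
  have hne (n : ℕ) : s n ≠ 0 := Multiset.card_pos.1 (hcard n ▸ Nat.succ_pos _)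
  have hmoment (m : ℕ) (hm : m ≠ 0) :
      Tendsto (fun n ↦ ((s n).card : ℝ)⁻¹ • ((s n).map (· ^ m)).sum) atTop (𝓝 0) := by
    refine tendsto_const_nhds.congr' ?_
    filter_upwards [eventually_ge_atTop (k * m)] with n hn
    have hsum := sum_roots_perronTrinomial_pow_eq_zero (K := ℂ) (N := n + (k + 1)) (k := k)
      (Nat.mul_pos hk.bot_lt hm.bot_lt) (by omega)
    simp [s, Multiset.map_map, ← pow_mul, hsum]
  have hdensity := tendsto_countP_div_card_of_tendsto_sum_pow hne
    (tendsto_norm_pow_roots_perronTrinomial (tendsto_add_atTop_nat (k + 1)) hk) hmoment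
    measurableSet_one_lt_norm_one_add circleMeasure_frontier_one_lt_norm_one_add
  rw [circleMeasure_one_lt_norm_one_add, ENNReal.toReal_div] at hdensity
  refine hdensity.congr fun n ↦ ?_
  rw [countP_one_lt_norm_roots_perronTrinomial (by omega), hcard]

end RootDensity

section SmallestPerron

theorem IsPerron.pos {n : ℕ} {α : ℝ} (h : IsPerron n α) : 0 < α := by
  classical
  have hint : IsIntegral ℚ α := h.isIntegral.tower_top
  have hcard : 1 < Fintype.card ((minpoly ℚ α).rootSet ℂ) := by
    rw [card_rootSet_eq_natDegree (minpoly.irreducible hint).separable (IsAlgClosed.splits _),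
      h.degree_eq]
    exact h.two_le
  have hmem : (α : ℂ) ∈ (minpoly ℚ α).rootSet ℂ := by
    refine mem_rootSet.2 ⟨minpoly.ne_zero hint, ?_⟩
    rw [← Complex.coe_algebraMap, aeval_algebraMap_apply, minpoly.aeval, map_zero]
  obtain ⟨z, hz⟩ := Fintype.exists_ne_of_one_lt_card hcard ⟨(α : ℂ), hmem⟩
  exact (norm_nonneg _).trans_lt (h.dominant z z.2 fun h' ↦ hz (Subtype.ext h'))

theorem IsPerron.norm_le {n : ℕ} {α : ℝ} (h : IsPerron n α) {z : ℂ} (hz : z ∈ conjugates α) :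
    ‖z‖ ≤ α := by
  rcases eq_or_ne z α with rfl | hne
  · rw [Complex.norm_real, Real.norm_of_nonneg h.pos.le]
  · exact (h.dominant z hz hne).le

theorem mahlerMeasure_le_pow_of_monic {p : ℂ[X]} (hp : p.Monic) {n : ℕ} (hdeg : p.natDegree ≤ n)
    {B : ℝ} (hB : ∀ z ∈ p.roots, ‖z‖ ≤ B) : p.mahlerMeasure ≤ max 1 B ^ n := by
  rw [mahlerMeasure_eq_leadingCoeff_mul_prod_roots, hp.leadingCoeff, norm_one, one_mul]
  calc (p.roots.map fun z ↦ max 1 ‖z‖).prod ≤ (p.roots.map fun _ ↦ max 1 B).prod :=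
        Multiset.prod_map_le_prod_map₀ _ _ (fun _ _ ↦ by positivity)
          fun z hz ↦ max_le_max_left 1 (hB z hz)
    _ = max 1 B ^ p.natDegree := by
        rw [Multiset.map_const', Multiset.prod_replicate, IsAlgClosed.card_roots_eq_natDegree]
    _ ≤ max 1 B ^ n := pow_le_pow_right₀ (le_max_left 1 B) hdeg

theorem finite_isIntegral_natDegree_le_norm_conjugates_le (n : ℕ) (B : ℝ) :
    {β : ℝ | IsIntegral ℤ β ∧ (minpoly ℚ β).natDegree ≤ n ∧
      ∀ z ∈ conjugates β, ‖z‖ ≤ B}.Finite := by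
  have hfin := finite_mahlerMeasure_le n (max 1 B ^ n).toNNReal
  refine (hfin.biUnion fun p _ ↦ p.rootSet_finite ℝ).subset fun β ⟨hint, hdeg, hconj⟩ ↦ ?_
  have hmonic := minpoly.monic hint
  have hmap : (minpoly ℤ β).map (Int.castRingHom ℂ) = (minpoly ℚ β).map (algebraMap ℚ ℂ) := by
    rw [minpoly.isIntegrallyClosed_eq_field_fractions' ℚ hint, Polynomial.map_map]
    congr 1
  have hdeg' : (minpoly ℤ β).natDegree = (minpoly ℚ β).natDegree := by
    rw [minpoly.isIntegrallyClosed_eq_field_fractions' ℚ hint, hmonic.natDegree_map]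
  refine Set.mem_biUnion (x := minpoly ℤ β) ⟨hdeg'.trans_le hdeg, ?_⟩
    (mem_rootSet.2 ⟨hmonic.ne_zero, minpoly.aeval ℤ β⟩)
  rw [Real.coe_toNNReal _ (by positivity)]
  refine mahlerMeasure_le_pow_of_monic (hmonic.map _) ?_ fun z hz ↦ hconj z ?_
  · rwa [hmonic.natDegree_map, hdeg']
  · rw [hmap] at hz
    simpa [conjugates, rootSet_def] using hz

theorem finite_isPerron_le (n : ℕ) (B : ℝ) : {β : ℝ | IsPerron n β ∧ β ≤ B}.Finite :=
  (finite_isIntegral_natDegree_le_norm_conjugates_le n B).subset fun _ ⟨hβ, hB⟩ ↦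
    ⟨hβ.isIntegral, hβ.degree_eq.le, fun _ hz ↦ (hβ.norm_le hz).trans hB⟩

theorem le_of_pow_le_add_one {n : ℕ} {α r : ℝ} (hα : 0 < α) (hpow : α ^ n = α + 1)
    (hr : r ^ n ≤ r + 1) : r ≤ α := by
  obtain _ | m := n
  · rw [pow_zero] at hpow
    linarith
  by_contra! hlt
  have hmono : α ^ m ≤ r ^ m := by gcongr
  have hgt : 1 < α ^ m := by
    by_contra! h
    nlinarith [pow_succ α m]
  nlinarith [pow_succ α m, pow_succ r m]

theorem eq_ofReal_of_pow_eq_add_one {n : ℕ} {α : ℝ} (hα : 0 < α) (hpow : α ^ n = α + 1) {z : ℂ}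
    (hz : z ^ n = z + 1) (hle : α ≤ ‖z‖) : z = α := by
  have hnorm : ‖z‖ ^ n = ‖z + 1‖ := by rw [← norm_pow, hz]
  have hα_eq : ‖z‖ = α := by
    refine (le_of_pow_le_add_one hα hpow ?_).antisymm hle
    simpa [hnorm] using norm_add_le z 1
  have hray : SameRay ℝ z 1 := sameRay_iff_norm_add.2 (by rw [← hnorm, hα_eq, hpow, norm_one])
  simpa [hα_eq] using (sameRay_iff_norm_smul_eq.1 hray).symm

theorem isPerron_of_pow_eq_add_one {n : ℕ} (hn : 2 ≤ n) {α : ℝ} (hα : 0 < α)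
    (hpow : α ^ n = α + 1) : IsPerron n α := by
  have hmonic (R : Type) [CommRing R] : (X ^ n - X - 1 : R[X]).Monic := by
    simpa [perronTrinomial] using monic_perronTrinomial (R := R) (N := n) (k := 1) (by omega)
  have hmin : minpoly ℚ α = X ^ n - X - 1 :=
    (minpoly.eq_of_irreducible_of_monic (X_pow_sub_X_sub_one_irreducible_rat (by omega))
      (by simp [hpow]) (hmonic ℚ)).symm
  refine ⟨⟨X ^ n - X - 1, hmonic ℤ, by simp [hpow]⟩, ?_, hn, fun z hz hne ↦ ?_⟩
  · simpa [hmin, perronTrinomial] using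
      natDegree_perronTrinomial (R := ℚ) (N := n) (k := 1) (by omega)
  · by_contra! hle
    refine hne (eq_ofReal_of_pow_eq_add_one hα hpow ?_ hle)
    have hroot := (mem_rootSet.1 hz).2
    simp only [hmin, map_sub, map_pow, aeval_X, map_one] at hroot
    linear_combination hroot

theorem exists_isPerron {n : ℕ} (hn : 2 ≤ n) : ∃ α : ℝ, IsPerron n α := by
  have hcont : ContinuousOn (fun x : ℝ ↦ x ^ n - x) (Set.Icc 1 2) := by fun_prop
  have hpow : (2 : ℝ) ^ 2 ≤ 2 ^ n := pow_le_pow_right₀ one_le_two hn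
  obtain ⟨α, hα, hroot⟩ := intermediate_value_Ioo one_le_two hcont
    (show (1 : ℝ) ∈ Set.Ioo _ _ from ⟨by norm_num, by linarith⟩)
  exact ⟨α, isPerron_of_pow_eq_add_one hn (one_pos.trans hα.1) (by linarith)⟩

theorem exists_isSmallestPerron {n : ℕ} (hn : 2 ≤ n) : ∃ α : ℝ, IsSmallestPerron n α := by
  obtain ⟨β, hβ⟩ := exists_isPerron hn
  obtain ⟨α, ⟨hα, hαβ⟩, hmin⟩ := Set.exists_min_image _ id (finite_isPerron_le n β) ⟨β, hβ, le_rfl⟩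
  refine ⟨α, hα, fun γ hγ ↦ ?_⟩
  rcases le_total γ β with h | h
  · exact hmin γ ⟨hγ, h⟩
  · exact hαβ.trans h

end SmallestPerron

section NuAsymptotics

open Topology

theorem nu_eq_countP_aroots_minpoly {α : ℝ} (hα : IsIntegral ℚ α) :
    nu α = ((minpoly ℚ α).aroots ℂ).countP (1 < ‖·‖) := by
  classical
  have hnodup : ((minpoly ℚ α).aroots ℂ).Nodup :=
    nodup_aroots_iff_of_splits (minpoly.ne_zero hα) (IsAlgClosed.splits _) |>.2
      (minpoly.irreducible hα).separable
  have hset : {z ∈ (minpoly ℚ α).rootSet ℂ | 1 < ‖z‖} =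
      (((minpoly ℚ α).aroots ℂ).filter (1 < ‖·‖)).toFinset := by
    ext z
    simp [rootSet]
  rw [nu, conjugates, hset, Set.ncard_coe_finset,
    Multiset.toFinset_card_of_nodup (hnodup.filter _), Multiset.countP_eq_card_filter]

theorem nu_eq_countP_aroots_of_minpoly_mul_eq {α : ℝ} {p q : ℚ[X]} (hp : p ≠ 0)
    (h : minpoly ℚ α * q = p) (hq : ∀ z ∈ q.aroots ℂ, ‖z‖ ≤ 1) :
    nu α = (p.aroots ℂ).countP (1 < ‖·‖) := by
  subst h
  have hα : IsIntegral ℚ α := minpoly.ne_zero_iff.1 (left_ne_zero_of_mul hp)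
  rw [aroots_mul hp, Multiset.countP_add, nu_eq_countP_aroots_minpoly hα, left_eq_add,
    Multiset.countP_eq_zero]
  exact fun z hz ↦ (hq z hz).not_gt

theorem norm_eq_one_of_mem_aroots_X_sq_sub_X_add_one {z : ℂ}
    (hz : z ∈ (X ^ 2 - X + 1 : ℚ[X]).aroots ℂ) : ‖z‖ = 1 := by
  have h : z ^ 2 - z + 1 = 0 := by simpa using (mem_aroots'.1 hz).2
  have h6 : z ^ 6 = 1 := by linear_combination (z ^ 4 + z ^ 3 - z - 1) * h
  exact Complex.norm_eq_one_of_pow_eq_one h6 (by norm_num)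

theorem nu_eq_countP_roots_perronTrinomial {α : ℝ} {q : ℚ[X]} {N k : ℕ} (hk : k < N)
    (h : minpoly ℚ α * q = perronTrinomial ℚ N k) (hq : ∀ z ∈ q.aroots ℂ, ‖z‖ ≤ 1) :
    nu α = (perronTrinomial ℂ N k).roots.countP (1 < ‖·‖) := by
  rw [nu_eq_countP_aroots_of_minpoly_mul_eq (monic_perronTrinomial hk).ne_zero h hq, aroots,
    map_perronTrinomial]

theorem tendsto_countP_roots_perronTrinomial_add_div {k : ℕ} (hk : k ≠ 0) (d : ℕ) :
    Tendsto (fun n : ℕ ↦ ((perronTrinomial ℂ (n + d) k).roots.countP (1 < ‖·‖) : ℝ) / n) atTop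
      (𝓝 (2 / 3)) := by
  have hcount := (tendsto_countP_roots_perronTrinomial_div hk).comp (tendsto_add_atTop_nat d)
  have hratio : Tendsto (fun n : ℕ ↦ 1 + (d : ℝ) / n) atTop (𝓝 (1 + 0)) :=
    tendsto_const_nhds.add (tendsto_const_div_atTop_nhds_zero_nat _)
  have hmul := hcount.mul hratio
  rw [add_zero, mul_one] at hmul
  refine hmul.congr' ?_
  filter_upwards [eventually_ne_atTop 0] with n hn
  have hn' : (n : ℝ) ≠ 0 := Nat.cast_ne_zero.2 hn
  have hnd : (n : ℝ) + d ≠ 0 := by positivity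
  simp only [Function.comp, Nat.cast_add]
  field_simp

theorem nu_eq_countP_roots_of_lindBoyd (hLB : LindBoydConjecture) {n : ℕ} {α : ℝ} (hn : 2 < n)
    (hα : IsSmallestPerron n α) :
    nu α = (perronTrinomial ℂ (n + 0) 1).roots.countP (1 < ‖·‖) ∨
    nu α = (perronTrinomial ℂ (n + 2) 4).roots.countP (1 < ‖·‖) ∨
    nu α = (perronTrinomial ℂ (n + 2) 2).roots.countP (1 < ‖·‖) := by
  obtain ⟨hgeneric, h3, h5⟩ := hLB n α hn hα
  have hcyclotomic : ∀ z ∈ (X ^ 2 - X + 1 : ℚ[X]).aroots ℂ, ‖z‖ ≤ 1 :=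
    fun z hz ↦ (norm_eq_one_of_mem_aroots_X_sq_sub_X_add_one hz).le
  by_cases hn3 : n % 6 = 3
  · exact .inr (.inl (nu_eq_countP_roots_perronTrinomial (by omega) (h3 hn3) hcyclotomic))
  by_cases hn5 : n % 6 = 5
  · exact .inr (.inr (nu_eq_countP_roots_perronTrinomial (by omega) (h5 hn5) hcyclotomic))
  · have hmin : minpoly ℚ α * 1 = perronTrinomial ℚ n 1 := by
      rw [mul_one, hgeneric hn3 hn5, perronTrinomial, pow_one]
    exact .inl (nu_eq_countP_roots_perronTrinomial (by omega) hmin (by simp))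

theorem tendsto_nu_div_of_lindBoyd (hLB : LindBoydConjecture) {α : ℕ → ℝ}
    (hα : ∀ n : ℕ, 2 < n → IsSmallestPerron n (α n)) :
    Tendsto (fun n : ℕ ↦ (nu (α n) : ℝ) / n) atTop (𝓝 (2 / 3)) := by
  have h₁ := tendsto_countP_roots_perronTrinomial_add_div one_ne_zero 0
  have h₂ := tendsto_countP_roots_perronTrinomial_add_div two_ne_zero 2
  have h₄ := tendsto_countP_roots_perronTrinomial_add_div four_ne_zero 2
  rw [tendsto_iff_forall_eventually_mem] at h₁ h₂ h₄ ⊢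
  intro s hs
  filter_upwards [h₁ s hs, h₂ s hs, h₄ s hs, eventually_gt_atTop 2] with n h₁ h₂ h₄ hn
  rcases nu_eq_countP_roots_of_lindBoyd hLB hn (hα n hn) with h | h | h <;> rwa [h]

end NuAsymptotics

theorem mainTheorem3 :
    (∀ n : ℕ, 2 < n → ∃ α : ℝ, IsSmallestPerron n α) ∧
    (LindBoydConjecture →
      ∀ α : ℕ → ℝ, (∀ n : ℕ, 2 < n → IsSmallestPerron n (α n)) →
        (fun n : ℕ => (nu (α n) : ℝ)) ~[atTop] (fun n : ℕ => (2 / 3 : ℝ) * (n : ℝ))) := by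
  refine ⟨fun n hn ↦ exists_isSmallestPerron hn.le, fun hLB α hα ↦ isEquivalent_of_tendsto_one ?_⟩
  have hdensity := (tendsto_nu_div_of_lindBoyd hLB hα).div_const (2 / 3)
  rw [div_self (by norm_num)] at hdensity
  refine hdensity.congr fun n ↦ ?_
  rw [Pi.div_apply, div_div, mul_comm (n : ℝ)]
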